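/- All graphs and digraphs are finite, non-empty, and without loops or multiple edges or arcs. For vertex-disjoint digraphs $G_1=(V_1,E_1)$ and $G_2=(V_2,E_2)$, the disjoint union $G_1\oplus G_2$, the order composition $G_1\oslash G_2$ and the series composition $G_1\otimes G_2$ have vertex set $V_1\cup V_2$ and arc sets $E_1\cup E_2$, $E_1\cup E_2\cup (V_1\times V_2)$ and $E_1\cup E_2\cup (V_1\times V_2)\cup(V_2\times V_1)$, respectively. Let $\bullet$ be the digraph with one vertex. The class of *directed trivially perfect graphs* is the smallest isomorphism-closed class of digraphs that contains $\bullet$, contains $G_1\oplus G_2$ whenever it contains $G_1$ and $G_2$, and contains $G\oslash\bullet$, $\bullet\oslash G$ and $G\otimes\bullet$ whenever it contains $G$. Likewise, *trivially perfect graphs* are the undirected graphs obtained from single vertices by disjoint union and by joining a single vertex to all vertices of a graph. The underlying graph $\mathrm{un}(G)$ has an edge $\{u,v\}$ whenever $(u,v)$ or $(v,u)$ is an arc of $G$. A (di)graph is $F$-free if none of its induced sub(di)graphs is isomorphic to a member of $F$. Write $a\to b$ for the arc $(a,b)$ without $(b,a)$, and $a\leftrightarrow b$ for both arcs; let $I_2$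 be the digraph with two vertices and no arcs, $\overrightarrow{P_2}$ the digraph $a\to b$ and $\overleftrightarrow{K_2}$ the digraph $a\leftrightarrow b$. The complement of a digraph has an arc $(u,v)$, $u\ne v$, exactly where the digraph has none. Define the digraphs $D_1,\dots,D_{15}$ as follows: - $D_1$: $a\to b\to c$; $D_2$: $a\to b\leftrightarrow c$; $D_3$: $a\leftarrow b\leftrightarrow c$; $D_4$: $a\to b\to c$ and $a\leftrightarrow c$; $D_5$: $a\to b\to c\to a$; - $D_7$: $a\leftrightarrow b\leftrightarrow c\leftrightarrow d$; $D_8$: $a\to b\leftarrow c\to d$; $D_6$: the complement of $D_8$; - $D_9=I_2\otimes I_2$; $D_{10}=I_2\otimes \overrightarrow{P_2}$; $D_{11}=\overrightarrow{P_2}\otimes\overrightarrow{P_2}$; - $D_{12}=I_2\oslash I_2$; $D_{13}=I_2\oslash\overleftrightarrow{K_2}$; $D_{14}=\overleftrightarrow{K_2}\oslash I_2$; $D_{15}=\overleftrightarrow{K_2}\oslash\overleftrightarrow{K_2}$. **Theorem.** Let $G$ be a digraph. The following are equivalent: 1. $G$ is a directed trivially perfect graph. 2. $G$ is $\{D_1,\dots,D_{15}\}$-free.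 3. $G$ is $\{D_1,\dots,D_6,D_{10},D_{11},D_{13},D_{14},D_{15}\}$-free and $\mathrm{un}(G)$ is $\{C_4,P_4\}$-free. 4. $G$ is $\{D_1,\dots,D_6,D_{10},D_{11},D_{13},D_{14},D_{15}\}$-free and $\mathrm{un}(G)$ is a trivially perfect graph. -/

import Mathlib

/-! Digraphs are Mathlib's `Digraph V` (a vertex type with an arbitrary adjacency relation); the
absence of loops is an explicit hypothesis where it is needed. -/

namespace DirectedTP

universe u v

/-! ### Compositions of vertex-disjoint digraphs -/

/-- The disjoint union `G ⊕ H`: no arcs between the two parts. -/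
def disjointUnion {V : Type u} {W : Type v} (G : Digraph V) (H : Digraph W) : Digraph (V ⊕ W) where
  Adj
    | Sum.inl a, Sum.inl b => G.Adj a b
    | Sum.inr a, Sum.inr b => H.Adj a b
    | Sum.inl _, Sum.inr _ => False
    | Sum.inr _, Sum.inl _ => False

/-- The order composition `G ⊘ H`: all arcs from vertices of `G` to vertices of `H`. -/
def orderComp {V : Type u} {W : Type v} (G : Digraph V) (H : Digraph W) : Digraph (V ⊕ W) where
  Adj
    | Sum.inl a, Sum.inl b => G.Adj a b
    | Sum.inr a, Sum.inr b => H.Adj a b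
    | Sum.inl _, Sum.inr _ => True
    | Sum.inr _, Sum.inl _ => False

/-- The series composition `G ⊗ H`: all arcs in both directions between the two parts. -/
def seriesComp {V : Type u} {W : Type v} (G : Digraph V) (H : Digraph W) : Digraph (V ⊕ W) where
  Adj
    | Sum.inl a, Sum.inl b => G.Adj a b
    | Sum.inr a, Sum.inr b => H.Adj a b
    | Sum.inl _, Sum.inr _ => True
    | Sum.inr _, Sum.inl _ => True

/-- The one-vertex digraph without arcs. -/
def point : Digraph PUnit.{u + 1} where
  Adj _ _ := False

/-- Directed trivially perfect graphs: the smallest class of digraphs, closed under isomorphism,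
that contains the one-vertex digraph and is closed under disjoint union and under the compositions
`G ⊘ •`, `• ⊘ G` and `G ⊗ •` with a single vertex. -/
inductive IsDirectedTriviallyPerfect : {V : Type u} → Digraph V → Prop
  | point : IsDirectedTriviallyPerfect point
  | disjointUnion {V W : Type u} {G : Digraph V} {H : Digraph W} :
      IsDirectedTriviallyPerfect G → IsDirectedTriviallyPerfect H →
        IsDirectedTriviallyPerfect (disjointUnion G H)
  | orderPoint {V : Type u} {G : Digraph V} :
      IsDirectedTriviallyPerfect G → IsDirectedTriviallyPerfect (orderComp G DirectedTP.point.{u})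
  | pointOrder {V : Type u} {G : Digraph V} :
      IsDirectedTriviallyPerfect G → IsDirectedTriviallyPerfect (orderComp DirectedTP.point.{u} G)
  | seriesPoint {V : Type u} {G : Digraph V} :
      IsDirectedTriviallyPerfect G → IsDirectedTriviallyPerfect (seriesComp G DirectedTP.point.{u})
  | iso {V W : Type u} {G : Digraph V} {H : Digraph W} (e : G.Adj ≃r H.Adj) :
      IsDirectedTriviallyPerfect G → IsDirectedTriviallyPerfect H

/-! ### Trivially perfect undirected graphs -/

/-- The join `G ⊗ H` of two vertex-disjoint undirected graphs. -/
def joinGraph {V : Type u} {W : Type v} (G : SimpleGraph V) (H : SimpleGraph W) :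
    SimpleGraph (V ⊕ W) :=
  G.sum H ⊔ completeBipartiteGraph V W

/-- Trivially perfect (undirected) graphs: the smallest class of graphs, closed under isomorphism,
that contains the one-vertex graph and is closed under disjoint union and under the join
`G ⊗ •` with a single vertex. -/
inductive IsTriviallyPerfect : {V : Type u} → SimpleGraph V → Prop
  | point : IsTriviallyPerfect (⊥ : SimpleGraph PUnit.{u + 1})
  | disjointUnion {V W : Type u} {G : SimpleGraph V} {H : SimpleGraph W} :
      IsTriviallyPerfect G → IsTriviallyPerfect H → IsTriviallyPerfect (G.sum H)
  | joinPoint {V : Type u} {G : SimpleGraph V} :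
      IsTriviallyPerfect G → IsTriviallyPerfect (joinGraph G (⊥ : SimpleGraph PUnit.{u + 1}))
  | iso {V W : Type u} {G : SimpleGraph V} {H : SimpleGraph W} (e : G ≃g H) :
      IsTriviallyPerfect G → IsTriviallyPerfect H

/-! ### Forbidden induced subdigraphs -/

/-- A digraph on a vertex set `{0, …, n - 1}`. -/
abbrev FinDigraph : Type := Σ n : ℕ, Digraph (Fin n)

/-- The digraph on `{0, …, n - 1}` with exactly the listed arcs. -/
def ofArcs (n : ℕ) (arcs : List (Fin n × Fin n)) : FinDigraph :=
  ⟨n, { Adj := fun a b => (a, b) ∈ arcs }⟩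

/-- `G` belongs to `Free F` if no induced subdigraph of `G` is isomorphic to a member of `F`.
A relation embedding preserves and reflects arcs, so it is exactly an isomorphism onto an induced
subdigraph. -/
def IsFree {V : Type u} (F : Set FinDigraph) (G : Digraph V) : Prop :=
  ∀ H ∈ F, ¬ Nonempty (H.2.Adj ↪r G.Adj)

/-- `0 → 1 → 2`, the oriented path on three vertices. -/
def D1 : FinDigraph := ofArcs 3 [(0, 1), (1, 2)]

/-- `0 → 1 ↔ 2`. -/
def D2 : FinDigraph := ofArcs 3 [(0, 1), (1, 2), (2, 1)]

/-- `0 ← 1 ↔ 2`. -/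
def D3 : FinDigraph := ofArcs 3 [(1, 0), (1, 2), (2, 1)]

/-- `0 → 1 → 2` together with `0 ↔ 2`; up to isomorphism the complement of `D1`. -/
def D4 : FinDigraph := ofArcs 3 [(0, 1), (1, 2), (0, 2), (2, 0)]

/-- The oriented cycle `0 → 1 → 2 → 0`. -/
def D5 : FinDigraph := ofArcs 3 [(0, 1), (1, 2), (2, 0)]

/-- The complement of `D8`: the bidirectional path `2 ↔ 0 ↔ 3 ↔ 1` together with the single arcs
`1 → 0`, `1 → 2`, `3 → 2`. -/
def D6 : FinDigraph :=
  ofArcs 4 [(2, 0), (0, 2), (0, 3), (3, 0), (3, 1), (1, 3), (1, 0), (1, 2), (3, 2)]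

/-- `0 ↔ 1 ↔ 2 ↔ 3`, the complete biorientation of the path on four vertices. -/
def D7 : FinDigraph := ofArcs 4 [(0, 1), (1, 0), (1, 2), (2, 1), (2, 3), (3, 2)]

/-- `0 → 1 ← 2 → 3`, the alternating orientation of the path on four vertices. -/
def D8 : FinDigraph := ofArcs 4 [(0, 1), (2, 1), (2, 3)]

/-- `I₂ ⊗ I₂`, the complete biorientation of the four-cycle; here and below the two parts are
`{0, 1}` and `{2, 3}`. -/
def D9 : FinDigraph :=
  ofArcs 4 [(0, 2), (0, 3), (1, 2), (1, 3), (2, 0), (3, 0), (2, 1), (3, 1)]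

/-- `I₂ ⊗ (2 → 3)`. -/
def D10 : FinDigraph :=
  ofArcs 4 [(0, 2), (0, 3), (1, 2), (1, 3), (2, 0), (3, 0), (2, 1), (3, 1), (2, 3)]

/-- `(0 → 1) ⊗ (2 → 3)`. -/
def D11 : FinDigraph :=
  ofArcs 4 [(0, 2), (0, 3), (1, 2), (1, 3), (2, 0), (3, 0), (2, 1), (3, 1), (0, 1), (2, 3)]

/-- `I₂ ⊘ I₂`. -/
def D12 : FinDigraph := ofArcs 4 [(0, 2), (0, 3), (1, 2), (1, 3)]

/-- `I₂ ⊘ (2 ↔ 3)`. -/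
def D13 : FinDigraph := ofArcs 4 [(0, 2), (0, 3), (1, 2), (1, 3), (2, 3), (3, 2)]

/-- `(0 ↔ 1) ⊘ I₂`. -/
def D14 : FinDigraph := ofArcs 4 [(0, 1), (1, 0), (0, 2), (0, 3), (1, 2), (1, 3)]

/-- `(0 ↔ 1) ⊘ (2 ↔ 3)`. -/
def D15 : FinDigraph :=
  ofArcs 4 [(0, 1), (1, 0), (0, 2), (0, 3), (1, 2), (1, 3), (2, 3), (3, 2)]

end DirectedTP

namespace DirectedTP

universe u

/-! ### Obstructions: connected relations without a homogeneous vertex -/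

/-! Each forbidden digraph is connected and has no source, sink or centre, that is, no vertex
related to all others in one same way (`IsObstruction`). This alone keeps it out of the class: by
induction on the construction, a copy in a disjoint union lies on one side, and a copy that uses the
point of a one-point composition would have such a vertex. The same argument excludes `C₄` and `P₄`
from trivially perfect graphs.

For the converse, the forbidden digraphs are turned into six local rules (`IsLocallyTP`), and one
inducts on the number of vertices. The underlying graph has no induced `P₄` or `C₄`, so a largest
closed neighbourhood either is everything or is separated from the rest (`exists_cut_or_joined`). A
separation gives a disjoint union. Otherwise some `v` is joined to all vertices, and the heart of
the proof, `exists_homogeneous`, finds a source, sink or centre to remove. It compares the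
`↔`-neighbours of `v` by which single neighbours of `v` they meet by `↔`: these sets form a chain.
The largest one yields a centre, or else a bipartition crossed only by single arcs. In the latter
case a minimal or a maximal vertex of the strict order `Arc` is a source or a sink
(`exists_homogeneous_of_single`). -/

/-- A relation on `Fin n` that does not split into two parts without arcs between them, and in
which no vertex is joined to all others in one of the three possible ways. -/
structure IsObstruction {n : ℕ} (r : Fin n → Fin n → Prop) : Prop where
  two_le : 2 ≤ n
  connected : ∀ s : Fin n → Bool, (∀ i j, r i j → s i = s j) → ∀ i j, s i = s j
  not_source : ∀ i, ∃ j, j ≠ i ∧ ¬ (r i j ∧ ¬ r j i)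
  not_sink : ∀ i, ∃ j, j ≠ i ∧ ¬ (r j i ∧ ¬ r i j)
  not_center : ∀ i, ∃ j, j ≠ i ∧ ¬ (r i j ∧ r j i)

/-- An embedding whose range lies in the left summand restricts to it. -/
theorem nonempty_relEmbedding_of_inl {α : Type*} {V W : Type*} {r : α → α → Prop}
    {s : V ⊕ W → V ⊕ W → Prop} {t : V → V → Prop} (ht : ∀ a b, s (.inl a) (.inl b) ↔ t a b)
    (f : r ↪r s) (h : ∀ i, (f i).isLeft) : Nonempty (r ↪r t) := by
  choose g hg using fun i => Sum.isLeft_iff.1 (h i)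
  refine ⟨⟨⟨g, fun i j hij => f.injective ?_⟩, fun {i j} => ?_⟩⟩
  · rw [hg, hg, hij]
  · rw [← f.map_rel_iff, hg, hg, ht]; rfl

/-- An embedding whose range lies in the right summand restricts to it. -/
theorem nonempty_relEmbedding_of_inr {α : Type*} {V W : Type*} {r : α → α → Prop}
    {s : V ⊕ W → V ⊕ W → Prop} {t : W → W → Prop} (ht : ∀ a b, s (.inr a) (.inr b) ↔ t a b)
    (f : r ↪r s) (h : ∀ i, (f i).isLeft = false) : Nonempty (r ↪r t) := by
  choose g hg using fun i => Sum.isRight_iff.1 (Sum.isLeft_eq_false.1 (h i))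
  refine ⟨⟨⟨g, fun i j hij => f.injective ?_⟩, fun {i j} => ?_⟩⟩
  · rw [hg, hg, hij]
  · rw [← f.map_rel_iff, hg, hg, ht]; rfl

/-- If a relation embeds into a one-point extension, either the extra point is used or it embeds
into the part without that point. -/
theorem nonempty_relEmbedding_or_of_point {α : Type*} {V : Type*} {r : α → α → Prop}
    {s : V ⊕ PUnit.{u + 1} → V ⊕ PUnit.{u + 1} → Prop} {t : V → V → Prop}
    (ht : ∀ a b, s (.inl a) (.inl b) ↔ t a b) (f : r ↪r s) :
    Nonempty (r ↪r t) ∨ ∃ i, ∀ j, j ≠ i → ∃ a, (r i j ↔ s (.inr ⟨⟩) (.inl a)) ∧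
      (r j i ↔ s (.inl a) (.inr ⟨⟩)) := by
  by_cases h : ∀ i, (f i).isLeft
  · exact .inl (nonempty_relEmbedding_of_inl ht f h)
  · right
    push Not at h
    obtain ⟨i, hi⟩ := h
    have hi' : f i = .inr ⟨⟩ := by
      rcases h : f i with a | a
      · simp [h] at hi
      · rfl
    refine ⟨i, fun j hj => ?_⟩
    rcases h : f j with a | a
    · exact ⟨a, by rw [← f.map_rel_iff, hi', h], by rw [← f.map_rel_iff, hi', h]⟩
    · exact absurd (f.injective (h.trans hi'.symm)) hj

namespace IsObstruction

variable {n : ℕ} {r : Fin n → Fin n → Prop}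

theorem isEmpty_of_subsingleton (hr : IsObstruction r) {V : Type*} [Subsingleton V]
    {s : V → V → Prop} : ¬ Nonempty (r ↪r s) := by
  rintro ⟨f⟩
  have h2 := hr.two_le
  have := congrArg Fin.val
    (f.injective (Subsingleton.elim (f ⟨0, by omega⟩) (f ⟨1, by omega⟩)))
  simp at this

/-- Landing in the left summand is a two-colouring constant along arcs, so `connected` forces the
whole image to one side. -/
theorem embeds_of_sum (hr : IsObstruction r) {V W : Type*} {s : V ⊕ W → V ⊕ W → Prop}
    {t : V → V → Prop} {t' : W → W → Prop} (ht : ∀ a b, s (.inl a) (.inl b) ↔ t a b)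
    (ht' : ∀ a b, s (.inr a) (.inr b) ↔ t' a b)
    (hlr : ∀ a b, ¬ s (.inl a) (.inr b)) (hrl : ∀ a b, ¬ s (.inr b) (.inl a)) (f : r ↪r s) :
    Nonempty (r ↪r t) ∨ Nonempty (r ↪r t') := by
  have h2 := hr.two_le
  have key := hr.connected (fun i => (f i).isLeft) fun i j hij => by
    rw [← f.map_rel_iff] at hij
    rcases hi : f i with a | a <;> rcases hj : f j with b | b <;> simp_all
  cases h : (f ⟨0, by omega⟩).isLeft
  · exact .inr (nonempty_relEmbedding_of_inr ht' f fun i => (key i _).trans h)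
  · exact .inl (nonempty_relEmbedding_of_inl ht f fun i => (key i _).trans h)

theorem not_embeds_directed (hr : IsObstruction r) {V : Type u} {G : Digraph V}
    (hG : IsDirectedTriviallyPerfect G) : ¬ Nonempty (r ↪r G.Adj) := by
  induction hG with
  | point => exact hr.isEmpty_of_subsingleton
  | disjointUnion _ _ ih₁ ih₂ =>
    rintro ⟨f⟩
    exact (hr.embeds_of_sum (fun _ _ => Iff.rfl) (fun _ _ => Iff.rfl) (fun _ _ => id)
      (fun _ _ => id) f).elim ih₁ ih₂
  | orderPoint _ ih =>
    rintro ⟨f⟩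
    refine (nonempty_relEmbedding_or_of_point (fun _ _ => Iff.rfl) f).elim ih ?_
    rintro ⟨i, hi⟩
    obtain ⟨j, hj, hn⟩ := hr.not_sink i
    obtain ⟨a, h₁, h₂⟩ := hi j hj
    exact hn ⟨h₂.2 trivial, h₁.1⟩
  | pointOrder _ ih =>
    rintro ⟨f⟩
    -- Here the extra point is the left summand, so `nonempty_relEmbedding_or_of_point` does not
    -- apply.
    by_cases h : ∀ i, (f i).isLeft = false
    · exact ih (nonempty_relEmbedding_of_inr (fun _ _ => Iff.rfl) f h)
    · push Not at h
      obtain ⟨i, hi⟩ := h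
      obtain ⟨j, hj, hn⟩ := hr.not_source i
      rw [← f.map_rel_iff, ← f.map_rel_iff] at hn
      have hij := f.injective.ne hj
      rcases hi' : f i with a | a
      · rcases hj' : f j with b | b
        · exact hij (by rw [hi', hj'])
        · rw [hi', hj'] at hn
          exact hn ⟨trivial, id⟩
      · simp [hi'] at hi
  | seriesPoint _ ih =>
    rintro ⟨f⟩
    refine (nonempty_relEmbedding_or_of_point (fun _ _ => Iff.rfl) f).elim ih ?_
    rintro ⟨i, hi⟩
    obtain ⟨j, hj, hn⟩ := hr.not_center i
    obtain ⟨a, h₁, h₂⟩ := hi j hj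
    exact hn ⟨h₁.2 trivial, h₂.2 trivial⟩
  | iso e _ ih => exact fun ⟨f⟩ => ih ⟨f.trans e.symm.toRelEmbedding⟩

theorem not_embeds_undirected (hr : IsObstruction r) {V : Type u} {G : SimpleGraph V}
    (hG : IsTriviallyPerfect G) : ¬ Nonempty (r ↪r G.Adj) := by
  induction hG with
  | point => exact hr.isEmpty_of_subsingleton
  | disjointUnion _ _ ih₁ ih₂ =>
    rintro ⟨f⟩
    exact (hr.embeds_of_sum (by simp) (by simp) (by simp) (by simp) f).elim ih₁ ih₂
  | @joinPoint V G _ ih =>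
    rintro ⟨f⟩
    refine (nonempty_relEmbedding_or_of_point (t := G.Adj) (by simp [joinGraph]) f).elim ih ?_
    rintro ⟨i, hi⟩
    obtain ⟨j, hj, hn⟩ := hr.not_center i
    obtain ⟨a, h₁, h₂⟩ := hi j hj
    exact hn ⟨h₁.2 (by simp [joinGraph]), h₂.2 (by simp [joinGraph])⟩
  | iso e _ ih => exact fun ⟨f⟩ => ih ⟨f.trans e.symm.toRelEmbedding⟩

end IsObstruction

/-- The forbidden induced subdigraphs of directed trivially perfect graphs. -/
def obstructions : Set FinDigraph :=
  {D1, D2, D3, D4, D5, D6, D7, D8, D9, D10, D11, D12, D13, D14, D15}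

theorem isObstruction_of_mem_obstructions {H : FinDigraph} (hH : H ∈ obstructions) :
    IsObstruction H.2.Adj := by
  simp only [obstructions, Set.mem_insert_iff, Set.mem_singleton_iff] at hH
  rcases hH with rfl | rfl | rfl | rfl | rfl | rfl | rfl | rfl | rfl | rfl | rfl | rfl | rfl |
    rfl | rfl <;>
  -- Once unfolded, adjacency is membership in an explicit list. Connectedness was stated through
  -- `Bool`-colourings so that `decide` can check it as well.
  · simp only [D1, D2, D3, D4, D5, D6, D7, D8, D9, D10, D11, D12, D13, D14, D15, ofArcs]
    constructor <;> decide

theorem isObstruction_cycleGraph_four : IsObstruction (SimpleGraph.cycleGraph 4).Adj := by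
  constructor <;> decide

theorem isObstruction_pathGraph_four : IsObstruction (SimpleGraph.pathGraph 4).Adj := by
  constructor <;> (try simp only [SimpleGraph.pathGraph_adj]) <;> decide

theorem IsDirectedTriviallyPerfect.isFree {V : Type u} {G : Digraph V}
    (hG : IsDirectedTriviallyPerfect G) : IsFree obstructions G :=
  fun _ hH => (isObstruction_of_mem_obstructions hH).not_embeds_directed hG

/-! ### Underlying graphs -/

theorem IsDirectedTriviallyPerfect.isTriviallyPerfect {V : Type u} {G : Digraph V}
    (hG : IsDirectedTriviallyPerfect G) : IsTriviallyPerfect G.toSimpleGraphInclusive := by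
  induction hG with
  | point => exact .iso ⟨Equiv.refl _, by simp [Digraph.toSimpleGraphInclusive]⟩ .point
  | disjointUnion _ _ ih₁ ih₂ =>
    refine .iso ⟨Equiv.refl _, ?_⟩ (.disjointUnion ih₁ ih₂)
    rintro (a | a) (b | b) <;> simp [Digraph.toSimpleGraphInclusive, DirectedTP.disjointUnion]
  | orderPoint _ ih =>
    refine .iso ⟨Equiv.refl _, ?_⟩ (.joinPoint ih)
    rintro (a | a) (b | b) <;>
      simp [Digraph.toSimpleGraphInclusive, joinGraph, orderComp]
  | pointOrder _ ih =>
    refine .iso ⟨Equiv.sumComm _ _, ?_⟩ (.joinPoint ih)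
    rintro (a | a) (b | b) <;>
      simp [Digraph.toSimpleGraphInclusive, joinGraph, orderComp]
  | seriesPoint _ ih =>
    refine .iso ⟨Equiv.refl _, ?_⟩ (.joinPoint ih)
    rintro (a | a) (b | b) <;>
      simp [Digraph.toSimpleGraphInclusive, joinGraph, seriesComp]
  | iso e _ ih =>
    refine .iso ⟨e.toEquiv, ?_⟩ ih
    simp [Digraph.toSimpleGraphInclusive, e.map_rel_iff]

/-- An embedding of digraphs induces an embedding of underlying graphs. -/
theorem isIndContained_of_relEmbedding {n : ℕ} {V : Type u} {r : Fin n → Fin n → Prop}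
    {G : Digraph V} {H : SimpleGraph (Fin n)} (e : Fin n ≃ Fin n)
    (hH : ∀ i j, H.Adj (e i) (e j) ↔ i ≠ j ∧ (r i j ∨ r j i)) (h : Nonempty (r ↪r G.Adj)) :
    H.IsIndContained G.toSimpleGraphInclusive := by
  obtain ⟨f⟩ := h
  refine ⟨⟨e.symm.toEmbedding.trans f.toEmbedding, fun {a b} => ?_⟩⟩
  have := hH (e.symm a) (e.symm b)
  simp only [Equiv.apply_symm_apply] at this
  simp [Digraph.toSimpleGraphInclusive, this, f.map_rel_iff]

/-- The shorter list omits only `D7` and `D8`, with underlying graph `P₄`, and `D9` and `D12`, with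
underlying graph `C₄`. -/
theorem isFree_obstructions_of_underlying {V : Type u} {G : Digraph V}
    (hG : IsFree {D1, D2, D3, D4, D5, D6, D10, D11, D13, D14, D15} G)
    (hC : ¬ (SimpleGraph.cycleGraph 4).IsIndContained G.toSimpleGraphInclusive)
    (hP : ¬ (SimpleGraph.pathGraph 4).IsIndContained G.toSimpleGraphInclusive) :
    IsFree obstructions G := by
  intro H hH
  by_cases h7 : H = D7
  · subst h7
    refine fun h => hP (isIndContained_of_relEmbedding (Equiv.refl (Fin 4)) ?_ h)
    simp only [SimpleGraph.pathGraph_adj, D7, ofArcs]; decide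
  by_cases h8 : H = D8
  · subst h8
    refine fun h => hP (isIndContained_of_relEmbedding (Equiv.refl (Fin 4)) ?_ h)
    simp only [SimpleGraph.pathGraph_adj, D8, ofArcs]; decide
  by_cases h9 : H = D9
  · subst h9
    -- The non-adjacent pairs are `{0, 1}`, `{2, 3}` in `D9` but `{0, 2}`, `{1, 3}` in the cycle;
    -- the swap matches them.
    refine fun h => hC (isIndContained_of_relEmbedding (Equiv.swap (1 : Fin 4) 2) ?_ h)
    simp only [D9, ofArcs]; decide
  by_cases h12 : H = D12
  · subst h12
    refine fun h => hC (isIndContained_of_relEmbedding (Equiv.swap (1 : Fin 4) 2) ?_ h)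
    simp only [D12, ofArcs]; decide
  refine hG H ?_
  simp only [obstructions, Set.mem_insert_iff, Set.mem_singleton_iff] at hH ⊢
  tauto

/-! ### Local structure of digraphs without obstructions -/

/-- `a → b`: the arc `(a, b)` without `(b, a)`. -/
def Arc {V : Type u} (G : Digraph V) (a b : V) : Prop := G.Adj a b ∧ ¬ G.Adj b a

/-- `a ↔ b`: both arcs. -/
def Bi {V : Type u} (G : Digraph V) (a b : V) : Prop := G.Adj a b ∧ G.Adj b a

/-- Exactly one of the two arcs between `a` and `b`. -/
def Single {V : Type u} (G : Digraph V) (a b : V) : Prop := Arc G a b ∨ Arc G b a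

/-- Adjacency in the underlying graph. -/
def Joined {V : Type u} (G : Digraph V) (a b : V) : Prop := G.Adj a b ∨ G.Adj b a

/-- The first-order consequences of the absence of obstructions. -/
structure IsLocallyTP {V : Type u} (G : Digraph V) : Prop where
  trans : ∀ {a b c}, Arc G a b → Arc G b c → Arc G a c
  bi_single : ∀ {a b c}, Bi G a b → Single G b c → Joined G a c
  bi_path : ∀ {a b c d}, Bi G a b → Bi G b c → Bi G c d → Single G a c → Single G a d →
    Single G b d → False
  series : ∀ {a b c d}, Bi G a c → Bi G a d → Bi G b c → Bi G b d → Single G c d → a ≠ b →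
    Bi G a b
  order : ∀ {a b c d}, Arc G a c → Arc G a d → Arc G b c → Arc G b d → ¬ Single G a b →
    ¬ Single G c d → a ≠ b → c ≠ d → False
  path : ∀ {a b c d}, Joined G a b → Joined G b c → Joined G c d → ¬ Joined G a c →
    ¬ Joined G b d → a ≠ c → b ≠ d → False

theorem relEmbedding_of_injective {n : ℕ} {V : Type u} {r : Fin n → Fin n → Prop}
    {G : Digraph V} (f : Fin n → V) (hf : ∀ i j, f i = f j → i = j)
    (h : ∀ i j, G.Adj (f i) (f j) ↔ r i j) : Nonempty (r ↪r G.Adj) :=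
  ⟨⟨⟨f, fun i j => hf i j⟩, fun {i j} => h i j⟩⟩

variable {V : Type u} {G : Digraph V}

/-- The other possibilities for the pair `a`, `c` give `D4`, `D5` and `D1`. -/
theorem arc_trans (hG : IsFree obstructions G) (h0 : ∀ x, ¬ G.Adj x x) {a b c : V}
    (hab : Arc G a b) (hbc : Arc G b c) : Arc G a c := by
  have hne1 : a ≠ b := by rintro rfl; exact h0 _ hab.1
  have hne2 : b ≠ c := by rintro rfl; exact h0 _ hbc.1
  have hne3 : a ≠ c := by rintro rfl; exact hab.2 hbc.1
  obtain ⟨h1, h2⟩ := hab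
  obtain ⟨h3, h4⟩ := hbc
  by_cases h5 : G.Adj a c <;> by_cases h6 : G.Adj c a
  · refine (hG D4 (by simp [obstructions]) (relEmbedding_of_injective ![a, b, c] ?_ ?_)).elim <;>
      simp [Fin.forall_fin_succ, D4, ofArcs, *, Ne.symm]
  · exact ⟨h5, h6⟩
  · refine (hG D5 (by simp [obstructions]) (relEmbedding_of_injective ![a, b, c] ?_ ?_)).elim <;>
      simp [Fin.forall_fin_succ, D5, ofArcs, *, Ne.symm]
  · refine (hG D1 (by simp [obstructions]) (relEmbedding_of_injective ![a, b, c] ?_ ?_)).elim <;>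
      simp [Fin.forall_fin_succ, D1, ofArcs, *, Ne.symm]

theorem joined_of_bi_of_single (hG : IsFree obstructions G) (h0 : ∀ x, ¬ G.Adj x x) {a b c : V}
    (hab : Bi G a b) (hbc : Single G b c) : Joined G a c := by
  by_contra hac
  have hne1 : a ≠ b := by rintro rfl; exact h0 _ hab.1
  have hne2 : b ≠ c := by rintro rfl; exact hbc.elim (fun h => h0 _ h.1) fun h => h0 _ h.1
  have hne3 : a ≠ c := by
    rintro rfl; exact hbc.elim (fun h => h.2 hab.1) fun h => h.2 hab.2
  obtain ⟨h1, h2⟩ := hab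
  obtain ⟨h5, h6⟩ := not_or.1 hac
  rcases hbc with ⟨h3, h4⟩ | ⟨h3, h4⟩
  · refine (hG D3 (by simp [obstructions]) (relEmbedding_of_injective ![c, b, a] ?_ ?_)).elim <;>
      simp [Fin.forall_fin_succ, D3, ofArcs, *, Ne.symm]
  · refine (hG D2 (by simp [obstructions]) (relEmbedding_of_injective ![c, b, a] ?_ ?_)).elim <;>
      simp [Fin.forall_fin_succ, D2, ofArcs, *, Ne.symm]

theorem Single.symm {a b : V} (h : Single G a b) : Single G b a := Or.symm h

theorem Bi.symm {a b : V} (h : Bi G a b) : Bi G b a := And.symm h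

theorem Joined.symm {a b : V} (h : Joined G a b) : Joined G b a := Or.symm h

theorem Joined.cases {a b : V} (h : Joined G a b) : Bi G a b ∨ Single G a b := by
  unfold Joined Bi Single Arc at *; tauto

theorem Bi.not_single {a b : V} (h : Bi G a b) : ¬ Single G a b := by
  unfold Bi Single Arc at *; tauto

/-- Transitivity propagates the orientation of `a → c` to `a → d` and then to `b → d`, since a
reversed arc would make a `↔` pair single. The result is `D6`. -/
theorem not_bi_path_of_arc (hG : IsFree obstructions G) (h0 : ∀ x, ¬ G.Adj x x) {a b c d : V}
    (hab : Bi G a b) (hbc : Bi G b c) (hcd : Bi G c d) (hac : Arc G a c) (had : Single G a d)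
    (hbd : Single G b d) : False := by
  have h1 : Arc G a d := had.resolve_right fun h => hcd.not_single
    (.inr (arc_trans hG h0 h hac))
  have h2 : Arc G b d := hbd.resolve_right fun h => hab.not_single
    (.inl (arc_trans hG h0 h1 h))
  have := h0 a
  have := h0 b
  have := h0 c
  have := h0 d
  obtain ⟨hab1, hab2⟩ := hab
  obtain ⟨hbc1, hbc2⟩ := hbc
  obtain ⟨hcd1, hcd2⟩ := hcd
  obtain ⟨hac1, hac2⟩ := hac
  obtain ⟨had1, had2⟩ := h1
  obtain ⟨hbd1, hbd2⟩ := h2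
  have hne1 : a ≠ b := by rintro rfl; contradiction
  have hne2 : a ≠ c := by rintro rfl; contradiction
  have hne3 : a ≠ d := by rintro rfl; contradiction
  have hne4 : b ≠ c := by rintro rfl; contradiction
  have hne5 : b ≠ d := by rintro rfl; contradiction
  have hne6 : c ≠ d := by rintro rfl; contradiction
  refine (hG D6 (by simp [obstructions]) (relEmbedding_of_injective ![c, a, d, b] ?_ ?_)).elim <;>
    simp [Fin.forall_fin_succ, D6, ofArcs, *, Ne.symm]

theorem not_bi_path (hG : IsFree obstructions G) (h0 : ∀ x, ¬ G.Adj x x) {a b c d : V}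
    (hab : Bi G a b) (hbc : Bi G b c) (hcd : Bi G c d) (hac : Single G a c) (had : Single G a d)
    (hbd : Single G b d) : False := by
  have key : ∀ {a b c d : V}, Bi G a b → Bi G b c → Bi G c d → Arc G a c → Single G a d →
    Single G b d → False := not_bi_path_of_arc hG h0
  rcases hac with hac | hca
  · exact key hab hbc hcd hac had hbd
  · have hda : Arc G d a := had.resolve_left fun h => hcd.not_single
      (.inl (arc_trans hG h0 hca h))
    have hdb : Arc G d b := hbd.resolve_left fun h => hab.not_single
      (.inr (arc_trans hG h0 h hda))
    -- With `c → a` all three arcs are reversed, so the path is read backwards.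
    exact key hcd.symm hbc.symm hab.symm hdb (.inl hda) (.inl hca)

theorem bi_of_series_arc (hG : IsFree obstructions G) (h0 : ∀ x, ¬ G.Adj x x) {a b c d : V}
    (hac : Bi G a c) (had : Bi G a d) (hbc : Bi G b c) (hbd : Bi G b d) (hcd : Arc G c d)
    (hab : a ≠ b) : Bi G a b := by
  by_contra hn
  have := h0 a
  have := h0 b
  have := h0 c
  have := h0 d
  obtain ⟨hac1, hac2⟩ := hac
  obtain ⟨had1, had2⟩ := had
  obtain ⟨hbc1, hbc2⟩ := hbc
  obtain ⟨hbd1, hbd2⟩ := hbd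
  obtain ⟨hcd1, hcd2⟩ := hcd
  have hne1 : a ≠ c := by rintro rfl; contradiction
  have hne2 : a ≠ d := by rintro rfl; contradiction
  have hne3 : b ≠ c := by rintro rfl; contradiction
  have hne4 : b ≠ d := by rintro rfl; contradiction
  have hne5 : c ≠ d := by rintro rfl; contradiction
  by_cases h1 : G.Adj a b <;> by_cases h2 : G.Adj b a
  · exact hn ⟨h1, h2⟩
  · refine (hG D11 (by simp [obstructions])
      (relEmbedding_of_injective ![a, b, c, d] ?_ ?_)).elim <;>
      simp [Fin.forall_fin_succ, D11, ofArcs, *, Ne.symm]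
  · refine (hG D11 (by simp [obstructions])
      (relEmbedding_of_injective ![b, a, c, d] ?_ ?_)).elim <;>
      simp [Fin.forall_fin_succ, D11, ofArcs, *, Ne.symm]
  · refine (hG D10 (by simp [obstructions])
      (relEmbedding_of_injective ![a, b, c, d] ?_ ?_)).elim <;>
      simp [Fin.forall_fin_succ, D10, ofArcs, *, Ne.symm]

theorem bi_of_series (hG : IsFree obstructions G) (h0 : ∀ x, ¬ G.Adj x x) {a b c d : V}
    (hac : Bi G a c) (had : Bi G a d) (hbc : Bi G b c) (hbd : Bi G b d) (hcd : Single G c d)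
    (hab : a ≠ b) : Bi G a b :=
  hcd.elim (fun h => bi_of_series_arc hG h0 hac had hbc hbd h hab)
    fun h => bi_of_series_arc hG h0 had hac hbd hbc h hab

theorem not_order (hG : IsFree obstructions G) (h0 : ∀ x, ¬ G.Adj x x) {a b c d : V}
    (hac : Arc G a c) (had : Arc G a d) (hbc : Arc G b c) (hbd : Arc G b d)
    (hab : ¬ Single G a b) (hcd : ¬ Single G c d) (hne : a ≠ b) (hne' : c ≠ d) : False := by
  have := h0 a
  have := h0 b
  have := h0 c
  have := h0 d
  obtain ⟨hac1, hac2⟩ := hac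
  obtain ⟨had1, had2⟩ := had
  obtain ⟨hbc1, hbc2⟩ := hbc
  obtain ⟨hbd1, hbd2⟩ := hbd
  have hne1 : a ≠ c := by rintro rfl; contradiction
  have hne2 : a ≠ d := by rintro rfl; contradiction
  have hne3 : b ≠ c := by rintro rfl; contradiction
  have hne4 : b ≠ d := by rintro rfl; contradiction
  have h1 : G.Adj b a ↔ G.Adj a b := by unfold Single Arc at hab; tauto
  have h2 : G.Adj d c ↔ G.Adj c d := by unfold Single Arc at hcd; tauto
  by_cases h3 : G.Adj a b <;> by_cases h4 : G.Adj c d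
  · refine (hG D15 (by simp [obstructions])
      (relEmbedding_of_injective ![a, b, c, d] ?_ ?_)).elim <;>
      simp [Fin.forall_fin_succ, D15, ofArcs, *, Ne.symm]
  · refine (hG D14 (by simp [obstructions])
      (relEmbedding_of_injective ![a, b, c, d] ?_ ?_)).elim <;>
      simp [Fin.forall_fin_succ, D14, ofArcs, *, Ne.symm]
  · refine (hG D13 (by simp [obstructions])
      (relEmbedding_of_injective ![a, b, c, d] ?_ ?_)).elim <;>
      simp [Fin.forall_fin_succ, D13, ofArcs, *, Ne.symm]
  · refine (hG D12 (by simp [obstructions])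
      (relEmbedding_of_injective ![a, b, c, d] ?_ ?_)).elim <;>
      simp [Fin.forall_fin_succ, D12, ofArcs, *, Ne.symm]

theorem not_bi_chordless (hG : IsFree obstructions G) (h0 : ∀ x, ¬ G.Adj x x) {a b c d : V}
    (hab : Bi G a b) (hbc : Bi G b c) (hcd : Bi G c d) (hac : ¬ Joined G a c)
    (hbd : ¬ Joined G b d) (hne : a ≠ c) (hne' : b ≠ d) : False := by
  have := h0 a
  have := h0 b
  have := h0 c
  have := h0 d
  -- The pair `a`, `d` is thus `↔` or empty, giving `D9` or `D7`.
  have had : ¬ Single G a d := fun h => hac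
    (joined_of_bi_of_single hG h0 hcd h.symm).symm
  obtain ⟨hab1, hab2⟩ := hab
  obtain ⟨hbc1, hbc2⟩ := hbc
  obtain ⟨hcd1, hcd2⟩ := hcd
  obtain ⟨hac1, hac2⟩ := not_or.1 hac
  obtain ⟨hbd1, hbd2⟩ := not_or.1 hbd
  have hne1 : a ≠ b := by rintro rfl; contradiction
  have hne2 : a ≠ d := by rintro rfl; contradiction
  have hne3 : b ≠ c := by rintro rfl; contradiction
  have hne4 : c ≠ d := by rintro rfl; contradiction
  have h1 : G.Adj d a ↔ G.Adj a d := by unfold Single Arc at had; tauto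
  by_cases h2 : G.Adj a d
  · refine (hG D9 (by simp [obstructions])
      (relEmbedding_of_injective ![a, c, b, d] ?_ ?_)).elim <;>
      simp [Fin.forall_fin_succ, D9, ofArcs, *, Ne.symm]
  · refine (hG D7 (by simp [obstructions])
      (relEmbedding_of_injective ![a, b, c, d] ?_ ?_)).elim <;>
      simp [Fin.forall_fin_succ, D7, ofArcs, *, Ne.symm]

theorem not_arc_chordless (hG : IsFree obstructions G) (h0 : ∀ x, ¬ G.Adj x x) {a b c d : V}
    (hab : Arc G a b) (hcb : Arc G c b) (hcd : Arc G c d) (hac : ¬ Joined G a c)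
    (hbd : ¬ Joined G b d) (hne : a ≠ c) (hne' : b ≠ d) : False := by
  have := h0 a
  have := h0 b
  have := h0 c
  have := h0 d
  have hda : ¬ Arc G d a := fun h => hac (.inr (arc_trans hG h0 hcd h).1)
  have had : ¬ Bi G a d := fun h => hac (joined_of_bi_of_single hG h0 h (.inr hcd))
  obtain ⟨hab1, hab2⟩ := hab
  obtain ⟨hcb1, hcb2⟩ := hcb
  obtain ⟨hcd1, hcd2⟩ := hcd
  obtain ⟨hac1, hac2⟩ := not_or.1 hac
  obtain ⟨hbd1, hbd2⟩ := not_or.1 hbd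
  have hne1 : a ≠ b := by rintro rfl; contradiction
  have hne2 : a ≠ d := by rintro rfl; contradiction
  have hne3 : b ≠ c := by rintro rfl; contradiction
  have hne4 : c ≠ d := by rintro rfl; contradiction
  have h1 : ¬ G.Adj d a := by unfold Arc at hda; unfold Bi at had; tauto
  by_cases h2 : G.Adj a d
  · refine (hG D12 (by simp [obstructions])
      (relEmbedding_of_injective ![a, c, b, d] ?_ ?_)).elim <;>
      simp [Fin.forall_fin_succ, D12, ofArcs, *, Ne.symm]
  · refine (hG D8 (by simp [obstructions])
      (relEmbedding_of_injective ![a, b, c, d] ?_ ?_)).elim <;>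
      simp [Fin.forall_fin_succ, D8, ofArcs, *, Ne.symm]

/-- The underlying graph has no induced path or cycle on four vertices. -/
theorem not_chordless (hG : IsFree obstructions G) (h0 : ∀ x, ¬ G.Adj x x) {a b c d : V}
    (hab : Joined G a b) (hbc : Joined G b c) (hcd : Joined G c d) (hac : ¬ Joined G a c)
    (hbd : ¬ Joined G b d) (hne : a ≠ c) (hne' : b ≠ d) : False := by
  have key : ∀ {x y z}, Bi G x y → Single G y z → Joined G x z := joined_of_bi_of_single hG h0
  have trans : ∀ {x y z}, Arc G x y → Arc G y z → Arc G x z := arc_trans hG h0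
  -- Without chords, consecutive pairs have the same type: all `↔` or all single. In the single case
  -- transitivity forces the arcs to alternate in direction.
  rcases hbc.cases with hbc | hbc
  · have hab := hab.cases.resolve_right fun h => hac (key hbc.symm h.symm).symm
    have hcd := hcd.cases.resolve_right fun h => hbd (key hbc h)
    exact not_bi_chordless hG h0 hab hbc hcd hac hbd hne hne'
  · have hab := hab.cases.resolve_left fun h => hac (key h hbc)
    have hcd := hcd.cases.resolve_left fun h => hbd (key h.symm hbc.symm).symm
    rcases hbc with hbc | hcb
    · have hba := hab.resolve_left fun h => hac (.inl (trans h hbc).1)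
      have hdc := hcd.resolve_left fun h => hbd (.inl (trans hbc h).1)
      exact not_arc_chordless hG h0 hdc hbc hba (fun h => hbd h.symm) (fun h => hac h.symm)
        hne'.symm hne.symm
    · have hab := hab.resolve_right fun h => hac (.inr (trans hcb h).1)
      have hcd := hcd.resolve_right fun h => hbd (.inr (trans h hcb).1)
      exact not_arc_chordless hG h0 hab hcb hcd hac hbd hne hne'

theorem IsFree.isLocallyTP (hG : IsFree obstructions G) (h0 : ∀ x, ¬ G.Adj x x) :
    IsLocallyTP G where
  trans := arc_trans hG h0
  bi_single := joined_of_bi_of_single hG h0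
  bi_path := not_bi_path hG h0
  series := bi_of_series hG h0
  order := not_order hG h0
  path := not_chordless hG h0

/-! ### Homogeneous vertices -/

theorem Arc.ne {a b : V} (h : Arc G a b) : a ≠ b := by rintro rfl; exact h.2 h.1

theorem Single.ne {a b : V} (h : Single G a b) : a ≠ b := h.elim Arc.ne fun h => h.ne.symm

/-- `v` is joined to all other vertices in the same of the three possible ways. -/
def IsHomogeneous (G : Digraph V) (v : V) : Prop :=
  (∀ x, x ≠ v → Arc G v x) ∨ (∀ x, x ≠ v → Arc G x v) ∨ ∀ x, x ≠ v → Bi G v x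

namespace IsLocallyTP

theorem exists_cut_or_joined (hG : IsLocallyTP G) [Finite V] [Nonempty V] :
    (∃ X : Set V, X.Nonempty ∧ Xᶜ.Nonempty ∧ ∀ x ∈ X, ∀ y ∉ X, ¬ Joined G x y) ∨
      ∃ v, ∀ x, x ≠ v → Joined G v x := by
  let N : V → Set V := fun v => {x | x = v ∨ Joined G v x}
  obtain ⟨v, hv⟩ := Finite.exists_max fun v => (N v).ncard
  by_cases huniv : ∀ x, x ∈ N v
  · exact .inr ⟨v, fun x hx => (huniv x).resolve_left hx⟩
  · left
    push Not at huniv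
    refine ⟨N v, ⟨v, .inl rfl⟩, huniv, fun u hu x hx hux => ?_⟩
    have hxv : x ≠ v ∧ ¬ Joined G v x := not_or.1 hx
    have hvu : Joined G v u := hu.resolve_left fun h => hxv.2 (h ▸ hux)
    -- Since `x` lies in `N u` but not in `N v`, an inclusion would contradict maximality. A vertex
    -- `y` of `N v` outside `N u` then makes `y, v, u, x` an induced path or four-cycle.
    have hsub : ¬ N v ⊆ N u := fun hsub =>
      (hv u).not_gt (Set.ncard_lt_ncard ⟨hsub, fun h => hx (h (.inr hux))⟩)
    obtain ⟨y, hy, hyu⟩ := Set.not_subset.1 hsub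
    obtain ⟨hyu, huy⟩ := not_or.1 hyu
    have hvy : Joined G v y := hy.resolve_left fun h => huy (h ▸ hvu.symm)
    exact hG.path hvy.symm hvu hux (fun h => huy h.symm) hxv.2 hyu hxv.1.symm

theorem exists_minimal (hG : IsLocallyTP G) [Finite V] [Nonempty V] :
    ∃ m, ∀ x, ¬ Arc G x m := by
  have : IsTrans V (Arc G) := ⟨fun _ _ _ => hG.trans⟩
  have : Std.Irrefl (Arc G) := ⟨fun _ h => h.2 h.1⟩
  obtain ⟨m, -, hm⟩ := (Finite.wellFounded_of_trans_of_irrefl (Arc G)).has_min Set.univ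
    Set.univ_nonempty
  exact ⟨m, fun x => hm x trivial⟩

theorem exists_maximal (hG : IsLocallyTP G) [Finite V] [Nonempty V] :
    ∃ m, ∀ x, ¬ Arc G m x := by
  have : IsTrans V fun a b => Arc G b a := ⟨fun _ _ _ h h' => hG.trans h' h⟩
  have : Std.Irrefl fun a b => Arc G b a := ⟨fun _ h => h.2 h.1⟩
  obtain ⟨m, -, hm⟩ := (Finite.wellFounded_of_trans_of_irrefl fun a b => Arc G b a).has_min
    Set.univ Set.univ_nonempty
  exact ⟨m, fun x => hm x trivial⟩

/-- If all pairs across some bipartition are single arcs, then there is a source or a sink. -/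
theorem exists_homogeneous_of_single (hG : IsLocallyTP G) [Finite V] {X : Set V}
    (hX : X.Nonempty) (hX' : Xᶜ.Nonempty) (h : ∀ x ∈ X, ∀ y ∉ X, Single G x y) :
    ∃ v, IsHomogeneous G v := by
  have : Nonempty V := ⟨hX.some⟩
  obtain ⟨m, hm⟩ := hG.exists_minimal
  obtain ⟨M, hM⟩ := hG.exists_maximal
  by_contra hno
  push Not at hno
  have hsrc := not_or.1 (hno m)
  have hsnk := not_or.1 (not_or.1 (hno M)).2
  have hsrc := hsrc.1
  have hsnk := hsnk.1
  push Not at hsrc hsnk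
  obtain ⟨z, hzm, hz⟩ := hsrc
  obtain ⟨w, hwM, hw⟩ := hsnk
  have hmz : ¬ Single G m z := not_or.2 ⟨hz, hm z⟩
  have hMw : ¬ Single G M w := not_or.2 ⟨hM w, hw⟩
  have hcross : ∀ x y, ¬ (x ∈ X ↔ y ∈ X) → Single G x y := by
    intro x y hxy
    by_cases hx : x ∈ X
    · exact h x hx y fun hy => hxy (by tauto)
    · exact (h y (by tauto) x hx).symm
  have hmz' : m ∈ X ↔ z ∈ X := not_not.1 fun h => hmz (hcross _ _ h)
  have hMw' : M ∈ X ↔ w ∈ X := not_not.1 fun h => hMw (hcross _ _ h)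
  -- If `m` is not a source, it has an unrelated or `↔` partner `z`, which lies on its side of the
  -- bipartition. Both point to everything on the other side; dually for `M` and `w`.
  have hlow : ∀ y, ¬ (m ∈ X ↔ y ∈ X) → Arc G m y ∧ Arc G z y := fun y hy => by
    have h1 := (hcross m y hy).resolve_right (hm y)
    exact ⟨h1, (hcross z y (by tauto)).resolve_right fun h => hz (hG.trans h1 h)⟩
  have hhigh : ∀ y, ¬ (M ∈ X ↔ y ∈ X) → Arc G y M ∧ Arc G y w := fun y hy => by
    have h1 := (hcross M y hy).resolve_left (hM y)
    exact ⟨h1, (hcross w y (by tauto)).symm.resolve_right fun h => hw (hG.trans h h1)⟩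
  have hall : Arc G m M ∧ Arc G m w ∧ Arc G z M ∧ Arc G z w := by
    by_cases hmM : m ∈ X ↔ M ∈ X
    -- When `m` and `M` are on the same side, arcs from `{m, z}` to `{M, w}` pass through any `y` on
    -- the other side.
    · obtain ⟨y, hy⟩ : ∃ y, ¬ (m ∈ X ↔ y ∈ X) := by
        obtain ⟨a, ha⟩ := hX
        obtain ⟨b, hb⟩ := hX'
        by_cases hmX : m ∈ X
        · exact ⟨b, fun h => hb (h.1 hmX)⟩
        · exact ⟨a, fun h => hmX (h.2 ha)⟩
      obtain ⟨h1, h2⟩ := hlow y hy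
      obtain ⟨h3, h4⟩ := hhigh y (by tauto)
      exact ⟨hG.trans h1 h3, hG.trans h1 h4, hG.trans h2 h3, hG.trans h2 h4⟩
    · exact ⟨(hlow M hmM).1, (hlow w (by tauto)).1, (hlow M hmM).2, (hlow w (by tauto)).2⟩
  exact hG.order hall.1 hall.2.1 hall.2.2.1 hall.2.2.2 hmz hMw hzm.symm hwM.symm

/-- In the neighbourhood of a universal vertex `v`, two single neighbours of `v` that a common
`↔`-neighbour of `v` distinguishes are joined by a single arc. -/
theorem single_of_distinguished (hG : IsLocallyTP G) {v b s t : V} (hb : Bi G v b)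
    (hs : Single G v s) (ht : Single G v t) (hbs : Bi G b s) (hbt : Single G b t) :
    Single G s t :=
  -- If `s ↔ t`, then `v ↔ b ↔ s ↔ t` violates `bi_path`.
  (hG.bi_single hbs.symm hbt).cases.resolve_left fun hst => hG.bi_path hb hbs hst hs ht hbt

/-- Two `↔`-neighbours of `v` that a single neighbour of `v` distinguishes are joined by `↔`. -/
theorem bi_of_distinguished (hG : IsLocallyTP G) {v b c s : V} (hb : Bi G v b) (hc : Bi G v c)
    (hs : Single G v s) (hbs : Bi G b s) (hcs : Single G c s) : Bi G b c :=
  -- If `b` and `c` were joined by a single arc, `c ↔ v ↔ b ↔ s` would violate `bi_path`.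
  (hG.bi_single hbs hcs.symm).cases.resolve_right fun hbc =>
    hG.bi_path hc.symm hb hbs hbc.symm hcs hs

theorem exists_homogeneous (hG : IsLocallyTP G) [Finite V] {v : V}
    (hv : ∀ x, x ≠ v → Joined G v x) : ∃ v, IsHomogeneous G v := by
  by_cases hS : ∀ x, x ≠ v → Bi G v x
  · exact ⟨v, .inr (.inr hS)⟩
  push Not at hS
  obtain ⟨s₀, hs₀, hvs₀⟩ := hS
  have hvs₀ : Single G v s₀ := (hv s₀ hs₀).cases.resolve_left hvs₀
  have hBS : ∀ {b s}, Bi G v b → Single G v s → Bi G b s ∨ Single G b s := fun hb hs =>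
    (hG.bi_single hb.symm hs).cases
  by_cases hB : ∃ b, Bi G v b
  · obtain ⟨b₁, hb₁⟩ := hB
    let S : V → Set V := fun b => {s | Single G v s ∧ Bi G b s}
    have : Nonempty {b // Bi G v b} := ⟨⟨b₁, hb₁⟩⟩
    obtain ⟨⟨b, hb⟩, hmax⟩ := Finite.exists_max fun b : {b // Bi G v b} => (S b).ncard
    -- Incomparable sets would give `s` in `S c` only and `t` in `S b` only, and then `s ↔ c ↔ b ↔
    -- t` violates `bi_path`. So the sets form a chain, and the largest contains all others.
    have hsub : ∀ c, Bi G v c → S c ⊆ S b := by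
      intro c hc
      by_contra hcb
      have hbc : ¬ S b ⊆ S c := fun hbc =>
        (hmax ⟨c, hc⟩).not_gt (Set.ncard_lt_ncard ⟨hbc, hcb⟩)
      obtain ⟨s, ⟨hs, hcs⟩, hs'⟩ := Set.not_subset.1 hcb
      obtain ⟨t, ⟨ht, hbt⟩, ht'⟩ := Set.not_subset.1 hbc
      have hbs := (hBS hb hs).resolve_left fun h => hs' ⟨hs, h⟩
      have hct := (hBS hc ht).resolve_left fun h => ht' ⟨ht, h⟩
      have hst := hG.single_of_distinguished hc hs ht hcs hct
      have hbc := hG.bi_of_distinguished hb hc ht hbt hct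
      exact hG.bi_path hcs.symm hbc.symm hbt hbs.symm hst hct
    by_cases hfull : ∀ s, Single G v s → Bi G b s
    · refine ⟨b, .inr (.inr fun x hx => ?_)⟩
      by_cases hxv : x = v
      · exact hxv ▸ hb.symm
      · rcases (hv x hxv).cases with hvx | hvx
        · rcases hBS hvx hvs₀ with hxs | hxs
          · exact hG.series hb.symm (hfull _ hvs₀) hvx.symm hxs hvs₀ hx.symm
          · exact hG.bi_of_distinguished hb hvx hvs₀ (hfull _ hvs₀) hxs
        · exact hfull x hvx
    · push Not at hfull
      obtain ⟨t₀, ht₀, hbt₀⟩ := hfull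
      -- By `hsub`, no `↔`-neighbour of `v` is `↔`-joined to a vertex of this set; the remaining
      -- single neighbours of `v` are distinguished from it by `b`.
      refine hG.exists_homogeneous_of_single (X := {t | Single G v t ∧ ¬ Bi G b t})
        ⟨t₀, ht₀, hbt₀⟩ ⟨v, fun h => h.1.ne rfl⟩ fun t ⟨ht, hbt⟩ x hx => ?_
      by_cases hxv : x = v
      · exact hxv ▸ ht.symm
      · rcases (hv x hxv).cases with hvx | hvx
        · exact ((hBS hvx ht).resolve_left fun h => hbt (hsub x hvx ⟨ht, h⟩).2).symm
        · have hbx : Bi G b x := not_not.1 fun h => hx ⟨hvx, h⟩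
          exact (hG.single_of_distinguished hb hvx ht hbx ((hBS hb ht).resolve_left hbt)).symm
  · refine hG.exists_homogeneous_of_single (X := {v}) ⟨v, rfl⟩ ⟨s₀, hs₀⟩ fun x hx y hy => ?_
    rw [Set.mem_singleton_iff.1 hx]
    exact (hv y hy).cases.resolve_left fun h => hB ⟨y, h⟩

end IsLocallyTP

/-! ### Decomposition -/

/-- The subdigraph induced by the vertices satisfying `p`. -/
def induced (G : Digraph V) (p : V → Prop) : Digraph {x // p x} where
  Adj a b := G.Adj a b

theorem IsFree.induced {F : Set FinDigraph} (hG : IsFree F G) (p : V → Prop) :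
    IsFree F (induced G p) :=
  fun H hH ⟨f⟩ => hG H hH ⟨f.trans (⟨Function.Embedding.subtype p, Iff.rfl⟩ :
    (DirectedTP.induced G p).Adj ↪r G.Adj)⟩

/-- Adding `v` to the remaining vertices. -/
theorem bijective_elim_point (v : V) :
    Function.Bijective (Sum.elim Subtype.val fun _ => v : {x // x ≠ v} ⊕ PUnit.{u + 1} → V) := by
  constructor
  · rintro (⟨a, ha⟩ | _) (⟨b, hb⟩ | _) <;> simp_all [Ne.symm]
  · intro x
    by_cases hx : x = v
    · exact ⟨.inr ⟨⟩, hx.symm⟩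
    · exact ⟨.inl ⟨x, hx⟩, rfl⟩

theorem isDirectedTriviallyPerfect_of_homogeneous (h0 : ∀ x, ¬ G.Adj x x) {v : V}
    (hv : IsHomogeneous G v) (ih : IsDirectedTriviallyPerfect (induced G (· ≠ v))) :
    IsDirectedTriviallyPerfect G := by
  rcases hv with hv | hv | hv
  · refine .iso ⟨(Equiv.sumComm _ _).trans (.ofBijective _ (bijective_elim_point v)), ?_⟩
      (.pointOrder ih)
    rintro (_ | ⟨a, ha⟩) (_ | ⟨b, hb⟩)
    · exact iff_of_false (h0 v) id
    · exact iff_of_true (hv b hb).1 trivial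
    · exact iff_of_false (hv a ha).2 id
    · exact Iff.rfl
  · refine .iso ⟨.ofBijective _ (bijective_elim_point v), ?_⟩ (.orderPoint ih)
    rintro (⟨a, ha⟩ | _) (⟨b, hb⟩ | _)
    · exact Iff.rfl
    · exact iff_of_true (hv a ha).1 trivial
    · exact iff_of_false (hv b hb).2 id
    · exact iff_of_false (h0 v) id
  · refine .iso ⟨.ofBijective _ (bijective_elim_point v), ?_⟩ (.seriesPoint ih)
    rintro (⟨a, ha⟩ | _) (⟨b, hb⟩ | _)
    · exact Iff.rfl
    · exact iff_of_true (hv a ha).2 trivial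
    · exact iff_of_true (hv b hb).1 trivial
    · exact iff_of_false (h0 v) id

theorem isDirectedTriviallyPerfect_of_cut {X : Set V}
    (hX : ∀ x ∈ X, ∀ y ∉ X, ¬ Joined G x y)
    (h₁ : IsDirectedTriviallyPerfect (induced G (· ∈ X)))
    (h₂ : IsDirectedTriviallyPerfect (induced G (· ∉ X))) : IsDirectedTriviallyPerfect G := by
  classical
  refine .iso ⟨Equiv.sumCompl (· ∈ X), ?_⟩ (.disjointUnion h₁ h₂)
  rintro (⟨a, ha⟩ | ⟨a, ha⟩) (⟨b, hb⟩ | ⟨b, hb⟩)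
  · exact Iff.rfl
  · exact iff_of_false (fun h => hX a ha b hb (.inl h)) id
  · exact iff_of_false (fun h => hX b hb a ha (.inr h)) id
  · exact Iff.rfl

theorem isDirectedTriviallyPerfect_of_unique (h0 : ∀ x, ¬ G.Adj x x) {v : V}
    (hv : ∀ x, x = v) : IsDirectedTriviallyPerfect G := by
  have : Unique V := ⟨⟨v⟩, hv⟩
  refine .iso ⟨Equiv.ofUnique PUnit.{u + 1} V, ?_⟩ .point
  exact fun {a b} => iff_of_false (fun h => h0 _ (Subsingleton.elim a b ▸ h)) id

theorem IsFree.isDirectedTriviallyPerfect [Finite V] [Nonempty V]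
    (hG : IsFree obstructions G) (h0 : ∀ x, ¬ G.Adj x x) : IsDirectedTriviallyPerfect G := by
  induction hn : Nat.card V using Nat.strong_induction_on generalizing V with
  | _ n ih =>
    subst hn
    have step : ∀ (p : V → Prop), (∃ x, p x) → (∃ x, ¬ p x) →
        IsDirectedTriviallyPerfect (DirectedTP.induced G p) := fun p ⟨a, ha⟩ ⟨b, hb⟩ => by
      have : Nonempty {x // p x} := ⟨⟨a, ha⟩⟩
      exact ih _ (Finite.card_subtype_lt hb) (hG.induced p) (fun x => h0 x) rfl
    have hloc := hG.isLocallyTP h0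
    rcases hloc.exists_cut_or_joined with ⟨X, hX, hX', hcut⟩ | ⟨v, hv⟩
    · exact isDirectedTriviallyPerfect_of_cut hcut (step _ hX hX')
        (step _ hX' (hX.imp fun _ h => not_not.2 h))
    · obtain ⟨w, hw⟩ := hloc.exists_homogeneous hv
      -- Removing the only vertex would leave the empty digraph, which is outside the class.
      by_cases h : ∀ x, x = w
      · exact isDirectedTriviallyPerfect_of_unique h0 h
      · push Not at h
        exact isDirectedTriviallyPerfect_of_homogeneous h0 hw
          (step _ h ⟨w, not_not.2 rfl⟩)

end DirectedTP

theorem mainTheorem1 {V : Type*} [Finite V] [Nonempty V] (G : Digraph V)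
    (hG : ∀ x : V, ¬ G.Adj x x) :
    List.TFAE [
      DirectedTP.IsDirectedTriviallyPerfect G,
      DirectedTP.IsFree {DirectedTP.D1, DirectedTP.D2, DirectedTP.D3, DirectedTP.D4,
        DirectedTP.D5, DirectedTP.D6, DirectedTP.D7, DirectedTP.D8, DirectedTP.D9,
        DirectedTP.D10, DirectedTP.D11, DirectedTP.D12, DirectedTP.D13, DirectedTP.D14,
        DirectedTP.D15} G,
      DirectedTP.IsFree {DirectedTP.D1, DirectedTP.D2, DirectedTP.D3, DirectedTP.D4,
        DirectedTP.D5, DirectedTP.D6, DirectedTP.D10, DirectedTP.D11, DirectedTP.D13,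
        DirectedTP.D14, DirectedTP.D15} G ∧
        ¬ (SimpleGraph.cycleGraph 4).IsIndContained G.toSimpleGraphInclusive ∧
        ¬ (SimpleGraph.pathGraph 4).IsIndContained G.toSimpleGraphInclusive,
      DirectedTP.IsFree {DirectedTP.D1, DirectedTP.D2, DirectedTP.D3, DirectedTP.D4,
        DirectedTP.D5, DirectedTP.D6, DirectedTP.D10, DirectedTP.D11, DirectedTP.D13,
        DirectedTP.D14, DirectedTP.D15} G ∧
        DirectedTP.IsTriviallyPerfect G.toSimpleGraphInclusive] := by
  tfae_have 1 → 2 := DirectedTP.IsDirectedTriviallyPerfect.isFree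
  tfae_have 2 → 1 := fun h => DirectedTP.IsFree.isDirectedTriviallyPerfect h hG
  tfae_have 1 → 4 := fun h => ⟨fun H hH => h.isFree H (by
    simp only [DirectedTP.obstructions, Set.mem_insert_iff, Set.mem_singleton_iff] at hH ⊢
    tauto), h.isTriviallyPerfect⟩
  tfae_have 4 → 3 := fun h => ⟨h.1,
    DirectedTP.isObstruction_cycleGraph_four.not_embeds_undirected h.2,
    DirectedTP.isObstruction_pathGraph_four.not_embeds_undirected h.2⟩
  tfae_have 3 → 2 := fun h => DirectedTP.isFree_obstructions_of_underlying h.1 h.2.1 h.2.2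
  tfae_finish
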